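/- Let $0<s<1$ and let $|\psi_1\rangle,|\psi_2\rangle,|\psi_3\rangle\in\mathbb C^3$ be unit vectors with $\langle\psi_i|\psi_j\rangle=s$ for all $i\ne j$. Let $|\phi_1\rangle,\dots,|\phi_6\rangle$ be the six product vectors $|\psi_i\rangle\otimes|\psi_j\rangle\in\mathbb C^3\otimes\mathbb C^3$, $i\neq j$ (in lexicographic order of $(i,j)$), let $\mathcal W$ be their span, and put $$\rho=\frac16\sum_{k=1}^6|\phi_k\rangle\langle\phi_k|,\qquad |\mu_k\rangle=\frac1{\sqrt6}\,\rho^{-1/2}|\phi_k\rangle ,$$ where $\rho^{-1/2}=\sum_{\lambda\ne0}\lambda^{-1/2}|\lambda\rangle\langle\lambda|$, the sum being over an orthonormal eigenbasis of $\rho$ with the zero eigenvalues omitted. Then $|\mu_1\rangle,\dots,|\mu_6\rangle$ form an orthonormal basis of $\mathcal W$, and they cannot be perfectly discriminated by LOCC: there is no measurement (POVM) $M_1,\dots,M_6$ on $\mathbb C^3\otimes\mathbb C^3$ that is implementable by local operations and classical communication between the two parties, with finitely or infinitely many rounds, such that $\langle\mu_j|M_i|\mu_j\rangle=\delta_{ij}$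 for all $i,j$. Here an LOCC measurement is a limit of the POVMs of finite-round LOCC protocols each of which continues the preceding one; a finite-round protocol is the case of a constant sequence. Moreover, for each $i$, any two product vectors $|\alpha\rangle\otimes|\beta\rangle$ and $|\gamma\rangle\otimes|\delta\rangle$ that lie in the $4$-dimensional subspace orthogonal to all $|\mu_j\rangle$, $j\neq i$, and that are not orthogonal to $|\mu_i\rangle$, are linearly dependent. -/

import Mathlib

open Matrix Filter Topology
open scoped Kronecker

noncomputable section

namespace LOCCDisc

/-- The product vector `|a⟩ ⊗ |b⟩`, with `ℂᵐ ⊗ ℂⁿ` realised on the index set `Fin m × Fin n`. -/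
def tens {m n : ℕ} (a : EuclideanSpace ℂ (Fin m)) (b : EuclideanSpace ℂ (Fin n)) :
    EuclideanSpace ℂ (Fin m × Fin n) :=
  WithLp.toLp 2 fun p => a p.1 * b p.2

/-- `M` perfectly discriminates the states `|v j⟩`: outcome `i` has probability
`⟨v j| M i |v j⟩ = δ_{ij}` on the `j`-th state. -/
def PerfectlyDiscriminates {Ω X : Type} [DecidableEq Ω] [Fintype X]
    (M : Ω → Matrix X X ℂ) (v : Ω → EuclideanSpace ℂ X) : Prop :=
  ∀ i j, star (v j).ofLp ⬝ᵥ (M i *ᵥ (v j).ofLp) = if i = j then 1 else 0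

/-- A bipartite finite-round LOCC measurement protocol with final classical outcomes in `Ω`, run
on `ℂᵐ ⊗ ℂⁿ`. In a round one party applies a quantum instrument to its own system: outcome
`i : Fin k` is the completely positive map `σ ↦ ∑ j, K i j * σ * (K i j)ᴴ` into a system of any
dimension, and the sum of these maps over `i` is trace preserving. The outcome `i` is announced,
and all later actions may depend on it. A protocol ends by declaring some `ω : Ω`. -/
inductive Protocol (Ω : Type) : ℕ → ℕ → Type
  | done {m n : ℕ} (ω : Ω) : Protocol Ω m n
  | alice {m n : ℕ} (k : ℕ) (m' r : Fin k → ℕ)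
      (K : (i : Fin k) → Fin (r i) → Matrix (Fin (m' i)) (Fin m) ℂ)
      (hK : ∑ i, ∑ j, (K i j)ᴴ * K i j = 1)
      (next : (i : Fin k) → Protocol Ω (m' i) n) : Protocol Ω m n
  | bob {m n : ℕ} (k : ℕ) (n' r : Fin k → ℕ)
      (K : (i : Fin k) → Fin (r i) → Matrix (Fin (n' i)) (Fin n) ℂ)
      (hK : ∑ i, ∑ j, (K i j)ᴴ * K i j = 1)
      (next : (i : Fin k) → Protocol Ω m (n' i)) : Protocol Ω m n

/-- The POVM implemented by a protocol (computed in the Heisenberg picture): the state `σ` leads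
to the declaration `ω` with probability `Tr (P.effect ω * σ)`. -/
def Protocol.effect {Ω : Type} [DecidableEq Ω] : {m n : ℕ} → Protocol Ω m n → Ω →
    Matrix (Fin m × Fin n) (Fin m × Fin n) ℂ
  | _, _, .done ω', ω => if ω' = ω then 1 else 0
  | _, n, .alice _ _ _ K _ next, ω => ∑ i, ∑ j,
      (K i j ⊗ₖ (1 : Matrix (Fin n) (Fin n) ℂ))ᴴ * (next i).effect ω *
        (K i j ⊗ₖ (1 : Matrix (Fin n) (Fin n) ℂ))
  | m, _, .bob _ _ _ K _ next, ω => ∑ i, ∑ j,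
      ((1 : Matrix (Fin m) (Fin m) ℂ) ⊗ₖ K i j)ᴴ * (next i).effect ω *
        ((1 : Matrix (Fin m) (Fin m) ℂ) ⊗ₖ K i j)

/-- `Extends P Q`: the protocol `Q` first runs exactly like `P`, and, where `P` would stop,
continues with some further rounds (possibly none) before it declares its outcome. -/
inductive Protocol.Extends {Ω : Type} : {m n : ℕ} → Protocol Ω m n → Protocol Ω m n → Prop
  | done {m n : ℕ} (ω : Ω) (Q : Protocol Ω m n) : Extends (.done ω) Q
  | alice {m n : ℕ} (k : ℕ) (m' r : Fin k → ℕ)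
      (K : (i : Fin k) → Fin (r i) → Matrix (Fin (m' i)) (Fin m) ℂ)
      (hK : ∑ i, ∑ j, (K i j)ᴴ * K i j = 1)
      (next next' : (i : Fin k) → Protocol Ω (m' i) n)
      (h : ∀ i, Extends (next i) (next' i)) :
      Extends (.alice k m' r K hK next) (.alice k m' r K hK next')
  | bob {m n : ℕ} (k : ℕ) (n' r : Fin k → ℕ)
      (K : (i : Fin k) → Fin (r i) → Matrix (Fin (n' i)) (Fin n) ℂ)
      (hK : ∑ i, ∑ j, (K i j)ᴴ * K i j = 1)
      (next next' : (i : Fin k) → Protocol Ω m (n' i))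
      (h : ∀ i, Extends (next i) (next' i)) :
      Extends (.bob k n' r K hK next) (.bob k n' r K hK next')

/-- LOCC measurements on `ℂᵐ ⊗ ℂⁿ`, with finitely or infinitely many rounds: `M` is the limit of
the POVMs of finite-round protocols each of which continues the preceding one. The measurements
that need only finitely many rounds are the case of a constant sequence. -/
def IsLOCC {Ω : Type} [DecidableEq Ω] {m n : ℕ}
    (M : Ω → Matrix (Fin m × Fin n) (Fin m × Fin n) ℂ) : Prop :=
  ∃ P : ℕ → Protocol Ω m n, (∀ t, (P t).Extends (P (t + 1))) ∧
    ∀ ω, Tendsto (fun t => (P t).effect ω) atTop (𝓝 (M ω))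

/-- The ordered pairs `(i, j)`, `i ≠ j`, in lexicographic order. -/
def pairs : Fin 6 → Fin 3 × Fin 3 :=
  ![(0, 1), (0, 2), (1, 0), (1, 2), (2, 0), (2, 1)]

/-- The six product states `|φ_k⟩ = |ψ_i⟩ ⊗ |ψ_j⟩`, `i ≠ j`. -/
def phi (ψ : Fin 3 → EuclideanSpace ℂ (Fin 3)) (k : Fin 6) :
    EuclideanSpace ℂ (Fin 3 × Fin 3) :=
  tens (ψ (pairs k).1) (ψ (pairs k).2)

/-- The average state `ρ = (1/6) ∑ k, |φ_k⟩⟨φ_k|`. -/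
def rho (ψ : Fin 3 → EuclideanSpace ℂ (Fin 3)) :
    Matrix (Fin 3 × Fin 3) (Fin 3 × Fin 3) ℂ :=
  (1 / 6 : ℂ) • ∑ k, vecMulVec (phi ψ k).ofLp (star (phi ψ k).ofLp)

/-- `ρ^{-1/2} = ∑ λ^{-1/2} |λ⟩⟨λ|` over the nonzero eigenvalues `λ` of `ρ`, by functional calculus.
The zero eigenvalues do not contribute since `(√0)⁻¹ = 0` in Lean. -/
def rhoInvSqrt (ψ : Fin 3 → EuclideanSpace ℂ (Fin 3)) :
    Matrix (Fin 3 × Fin 3) (Fin 3 × Fin 3) ℂ :=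
  cfc (fun x : ℝ => (√x)⁻¹) (rho ψ)

/-- The square-root-measurement vectors `|μ_k⟩ = ρ^{-1/2} |φ_k⟩ / √6`. -/
def mu (ψ : Fin 3 → EuclideanSpace ℂ (Fin 3)) (k : Fin 6) :
    EuclideanSpace ℂ (Fin 3 × Fin 3) :=
  WithLp.toLp 2 (((√6 : ℝ) : ℂ)⁻¹ • (rhoInvSqrt ψ *ᵥ (phi ψ k).ofLp))

end LOCCDisc

end

/-!
The measurement in the vectors `μ k` cannot even be completed to a separable POVM, and every LOCC
measurement, with finitely or infinitely many rounds, is separable.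

*The vectors.* Let `Φ` be the matrix of the six product states and `G = Φᴴ Φ` their Gram matrix. `G`
lies in a commutative algebra of `6 × 6` matrices (`pattern`) with four common eigenspaces, so every
function of it is explicit (`gramFun`). As `ρ = Φ Φᴴ / 6`, the matrix `Φ` maps eigenvectors of `G` to
eigenvectors of `ρ`, whence `μ = Φ G^{-1/2}` (`muMat_eq`). Orthonormality and the equality of spans
follow.

*Uniqueness of product vectors.* If `a ⊗ b` is orthogonal to all `μ j`, `j ≠ k`, the numbers
`⟨ψ m|a⟩⟨ψ n|b⟩`, `m ≠ n`, are a multiple of the `k`-th column of `G^{1/2}`. They are the off-diagonal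
entries of a rank-one `3 × 3` matrix. Enough of them are nonzero (`diagCoeff_pos`, `shareCoeff_pos`)
to determine its diagonal, and hence `a ⊗ b` up to a scalar (`smul_tens_eq_smul_tens`). On the other
hand the coefficients of `μ k` in the basis `ψ m ⊗ ψ n` form a matrix with zero diagonal which is not
of rank one, so `μ k` is not a product vector (`mu_ne_tens`).

*Separability.* The effects of a finite protocol are finite sums of operators `|a ⊗ b⟩⟨a ⊗ b|`
(`Protocol.effect_mem_separable`). The cone of such sums is closed (`mem_separable_of_tendsto`), as
the convex hull of a compact set in finite dimension is compact by Carathéodory's theorem. So the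
limit of the protocols is a separable POVM too.

*Contradiction.* If a separable POVM `M` discriminates the `μ k` perfectly, then `M k` fixes `μ k`.
But each of the product vectors `a ⊗ b` composing `M k` is orthogonal to all `μ j`, `j ≠ k`, and those
not orthogonal to `μ k` are all proportional, so `M k` maps `μ k` to a product vector
(`mulVec_mem_span_of_mem_separable`), which `μ k` is not.
-/

noncomputable section

namespace LOCCDisc

open scoped ComplexOrder Pointwise

/-! ### Functional calculus on eigenvectors -/

/-- If the columns of `B` are eigenvectors of `A` with eigenvalue `r`, they are eigenvectors of
`f(A)` with eigenvalue `f r`. -/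
lemma cfc_mul_of_mul_eq_smul {X Y : Type*} [Fintype X] [DecidableEq X] [Fintype Y]
    {A : Matrix X X ℂ} (hA : A.IsHermitian) (f : ℝ → ℝ) {B : Matrix X Y ℂ} {r : ℝ}
    (h : A * B = (r : ℂ) • B) : cfc f A * B = ((f r : ℝ) : ℂ) • B := by
  -- On the finite set `spectrum ℝ A ∪ {r}` the function `f` agrees with a polynomial `q`.
  have hfin : (spectrum ℝ A ∪ {r}).Finite := A.finite_real_spectrum.union (Set.finite_singleton r)
  set S : Finset ℝ := hfin.toFinset with hS
  set q := Lagrange.interpolate S id f with hq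
  have hqe : ∀ x ∈ S, q.eval x = f x := fun x hx =>
    Lagrange.eval_interpolate_at_node (v := id) f (Function.injective_id.injOn) hx
  have h1 : cfc f A = Polynomial.aeval A q := by
    rw [← cfc_polynomial q A hA.isSelfAdjoint]
    exact cfc_congr fun x hx => (hqe x (by simp [hS, hx])).symm
  rw [h1, ← hqe r (by simp [hS])]
  clear h1 hqe hq
  induction q using Polynomial.induction_on' with
  | add p q hp hq => simp [Matrix.add_mul, hp, hq, add_smul]
  | monomial n c =>
    have hpow : A ^ n * B = ((r : ℂ) ^ n) • B := by
      induction n with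
      | zero => simp
      | succ n ih => rw [pow_succ, Matrix.mul_assoc, h, Matrix.mul_smul, ih, smul_smul, pow_succ']
    rw [Polynomial.aeval_monomial, Matrix.mul_assoc, hpow, Algebra.algebraMap_eq_smul_one,
      Matrix.smul_mul, Matrix.one_mul]
    ext i j
    simp [mul_assoc]

/-! ### The commutant pattern of the Gram matrix -/

/-- The `6 × 6` matrix, indexed by the ordered pairs `pairs`, with eigenvalues `p`, `q` (each
simple) and `u`, `v` (each double) on four fixed eigenspaces. Its entry at two pairs depends only on
whether they are equal, share exactly one position, are swaps of each other, or neither. Identifying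
a pair `(i, j)` with the permutation `1 ↦ i, 2 ↦ j` of three letters, these are elements of the group
algebra of `S₃`; the eigenspaces come from the trivial, the sign and the standard representation,
the last split by the transposition `(1 2)`. -/
def pattern (p q u v : ℝ) : Matrix (Fin 6) (Fin 6) ℂ := fun k l =>
  (((if k = l then (p + q) / 6 + (u + v) / 3
  else if (pairs k).1 = (pairs l).1 ∨ (pairs k).2 = (pairs l).2 then (p - q - u + v) / 6
  else if (pairs k).1 = (pairs l).2 ∧ (pairs k).2 = (pairs l).1 then (p - q) / 6 + (u - v) / 3
  else (p + q - u - v) / 6 : ℝ)) : ℂ)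

lemma pattern_conjTranspose (p q u v : ℝ) : (pattern p q u v)ᴴ = pattern p q u v := by
  ext k l
  fin_cases k <;> fin_cases l <;> simp [pattern, pairs]

lemma pattern_one : pattern 1 1 1 1 = 1 := by
  ext k l
  fin_cases k <;> fin_cases l <;> simp [pattern, pairs] <;> norm_num

lemma pattern_mul (p q u v p' q' u' v' : ℝ) :
    pattern p q u v * pattern p' q' u' v' = pattern (p * p') (q * q') (u * u') (v * v') := by
  ext k l
  fin_cases k <;> fin_cases l <;>
    simp [Matrix.mul_apply, Fin.sum_univ_succ, pattern, pairs] <;> ring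

lemma pattern_smul (c p q u v : ℝ) :
    (c : ℂ) • pattern p q u v = pattern (c * p) (c * q) (c * u) (c * v) := by
  ext k l
  fin_cases k <;> fin_cases l <;> simp [pattern, pairs] <;> ring

lemma pattern_add (p q u v p' q' u' v' : ℝ) :
    pattern p q u v + pattern p' q' u' v' = pattern (p + p') (q + q') (u + u') (v + v') := by
  ext k l
  fin_cases k <;> fin_cases l <;> simp [pattern, pairs] <;> ring

/-! ### The square-root-measurement vectors -/

lemma inner_tens {m n : ℕ} (a c : EuclideanSpace ℂ (Fin m)) (b d : EuclideanSpace ℂ (Fin n)) :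
    inner ℂ (tens a b) (tens c d) = inner ℂ a c * inner ℂ b d := by
  simp only [tens, PiLp.inner_apply, RCLike.inner_apply, Fintype.sum_prod_type, map_mul,
    Finset.sum_mul_sum]
  refine Finset.sum_congr rfl fun i _ => Finset.sum_congr rfl fun j _ => ?_
  ring

/-- The function `f` of the Gram matrix `G` of the six product states. The four arguments of `f` are
the eigenvalues of `G`; `gramFun s id` is `G` itself (`phiMat_conjTranspose_mul`). -/
def gramFun (s : ℝ) (f : ℝ → ℝ) : Matrix (Fin 6) (Fin 6) ℂ :=
  pattern (f (1 + 2 * s + 3 * s ^ 2)) (f ((1 - s) ^ 2)) (f (1 - s)) (f ((1 - s) * (1 + 2 * s)))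

lemma gramFun_mul (s : ℝ) (f g : ℝ → ℝ) :
    gramFun s f * gramFun s g = gramFun s (fun x => f x * g x) := pattern_mul ..

lemma gramFun_eq_one {s : ℝ} (hs : s ∈ Set.Ioo (0 : ℝ) 1) {f : ℝ → ℝ} (hf : ∀ x > 0, f x = 1) :
    gramFun s f = 1 := by
  obtain ⟨h0, h1⟩ := hs
  have : 0 < 1 - s := by linarith
  rw [gramFun, hf _ (by positivity), hf _ (by positivity), hf _ this, hf _ (by positivity),
    pattern_one]

/-- The matrix whose columns are the six product states. -/
def phiMat (ψ : Fin 3 → EuclideanSpace ℂ (Fin 3)) : Matrix (Fin 3 × Fin 3) (Fin 6) ℂ :=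
  fun p k => phi ψ k p

lemma rho_eq (ψ : Fin 3 → EuclideanSpace ℂ (Fin 3)) :
    rho ψ = (1 / 6 : ℂ) • (phiMat ψ * (phiMat ψ)ᴴ) := by
  rw [rho]
  congr 1

lemma rho_isHermitian (ψ : Fin 3 → EuclideanSpace ℂ (Fin 3)) : (rho ψ).IsHermitian := by
  rw [rho_eq, Matrix.IsHermitian, Matrix.conjTranspose_smul, Matrix.conjTranspose_mul,
    Matrix.conjTranspose_conjTranspose]
  simp

variable {s : ℝ} {ψ : Fin 3 → EuclideanSpace ℂ (Fin 3)}

lemma inner_eq_ite (hnorm : ∀ i, ‖ψ i‖ = 1) (hinner : ∀ i j, i ≠ j → inner ℂ (ψ i) (ψ j) = (s : ℂ))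
    (i j : Fin 3) : inner ℂ (ψ i) (ψ j) = if i = j then 1 else (s : ℂ) := by
  split_ifs with h
  · subst h
    simp [inner_self_eq_norm_sq_to_K, hnorm]
  · exact hinner i j h

lemma phiMat_conjTranspose_mul (hnorm : ∀ i, ‖ψ i‖ = 1)
    (hinner : ∀ i j, i ≠ j → inner ℂ (ψ i) (ψ j) = (s : ℂ)) :
    (phiMat ψ)ᴴ * phiMat ψ = gramFun s id := by
  ext k l
  have h : ((phiMat ψ)ᴴ * phiMat ψ) k l = inner ℂ (phi ψ k) (phi ψ l) := by
    simp [Matrix.mul_apply, phiMat, PiLp.inner_apply, mul_comm]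
  rw [h, phi, phi, inner_tens, inner_eq_ite hnorm hinner, inner_eq_ite hnorm hinner]
  fin_cases k <;> fin_cases l <;> simp [gramFun, pattern, pairs] <;> ring

/-- `ρ^{-1/2} Φ = Φ (G/6)^{-1/2}`, because `ρ = Φ Φᴴ / 6` and `G = Φᴴ Φ`. -/
lemma rhoInvSqrt_mul_phiMat (hnorm : ∀ i, ‖ψ i‖ = 1)
    (hinner : ∀ i j, i ≠ j → inner ℂ (ψ i) (ψ j) = (s : ℂ)) :
    rhoInvSqrt ψ * phiMat ψ =
      phiMat ψ * gramFun s (fun x => (√(x / 6))⁻¹) := by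
  have key : ∀ (E : Matrix (Fin 6) (Fin 6) ℂ) (r : ℝ), gramFun s id * E = (r : ℂ) • E →
      rhoInvSqrt ψ * (phiMat ψ * E) = phiMat ψ * ((((√(r / 6))⁻¹ : ℝ) : ℂ) • E) := by
    intro E r hE
    rw [rhoInvSqrt, cfc_mul_of_mul_eq_smul (rho_isHermitian ψ) _ (r := r / 6), Matrix.mul_smul]
    rw [rho_eq, Matrix.smul_mul, Matrix.mul_assoc, ← Matrix.mul_assoc _ (phiMat ψ),
      phiMat_conjTranspose_mul hnorm hinner, hE, Matrix.mul_smul, smul_smul]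
    congr 1
    push_cast
    ring
  -- The four spectral projections of the Gram matrix add up to the identity.
  have h1 : (1 : Matrix (Fin 6) (Fin 6) ℂ) =
      pattern 1 0 0 0 + pattern 0 1 0 0 + pattern 0 0 1 0 + pattern 0 0 0 1 := by
    simp [pattern_add, pattern_one]
  rw [← Matrix.mul_one (phiMat ψ), h1]
  simp only [Matrix.mul_add]
  rw [key _ (1 + 2 * s + 3 * s ^ 2), key _ ((1 - s) ^ 2), key _ (1 - s),
    key _ ((1 - s) * (1 + 2 * s)), ← Matrix.mul_add, ← Matrix.mul_add, ← Matrix.mul_add,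
    ← Matrix.mul_add, ← Matrix.mul_add, ← Matrix.mul_add, ← h1, Matrix.mul_one]
  · simp only [gramFun, pattern_smul, pattern_add, mul_one, mul_zero, add_zero, zero_add]
  all_goals simp only [gramFun, pattern_smul, pattern_mul, mul_one, mul_zero, id]

/-- The matrix whose columns are the square-root-measurement vectors. -/
def muMat (ψ : Fin 3 → EuclideanSpace ℂ (Fin 3)) : Matrix (Fin 3 × Fin 3) (Fin 6) ℂ :=
  fun p k => mu ψ k p

/-- `μ = Φ G^{-1/2}`. -/
lemma muMat_eq (hnorm : ∀ i, ‖ψ i‖ = 1)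
    (hinner : ∀ i j, i ≠ j → inner ℂ (ψ i) (ψ j) = (s : ℂ)) :
    muMat ψ = phiMat ψ * gramFun s (fun x => (√x)⁻¹) := by
  have h : muMat ψ = (((√6)⁻¹ : ℝ) : ℂ) • (rhoInvSqrt ψ * phiMat ψ) := by
    ext p k
    simp [muMat, mu, phiMat, Matrix.mul_apply, Matrix.mulVec, dotProduct]
  rw [h, rhoInvSqrt_mul_phiMat hnorm hinner, ← Matrix.mul_smul, gramFun, pattern_smul, gramFun]
  have h6 : √(6 : ℝ) ≠ 0 := by positivity
  have : ∀ x : ℝ, (√6)⁻¹ * (√(x / 6))⁻¹ = (√x)⁻¹ := fun x => by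
    rw [Real.sqrt_div' x (by norm_num)]
    field_simp
  simp only [this]

/-- `Φ = μ G^{1/2}`. -/
lemma phiMat_eq (hs : s ∈ Set.Ioo (0 : ℝ) 1) (hnorm : ∀ i, ‖ψ i‖ = 1)
    (hinner : ∀ i j, i ≠ j → inner ℂ (ψ i) (ψ j) = (s : ℂ)) :
    phiMat ψ = muMat ψ * gramFun s Real.sqrt := by
  rw [muMat_eq hnorm hinner, Matrix.mul_assoc, gramFun_mul, gramFun_eq_one hs, Matrix.mul_one]
  intro x hx
  exact inv_mul_cancel₀ (Real.sqrt_pos.2 hx).ne'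

lemma mu_eq_sum (hnorm : ∀ i, ‖ψ i‖ = 1)
    (hinner : ∀ i j, i ≠ j → inner ℂ (ψ i) (ψ j) = (s : ℂ)) (k : Fin 6) :
    mu ψ k = ∑ l, gramFun s (fun x => (√x)⁻¹) l k • phi ψ l := by
  ext p
  have := congrFun (congrFun (muMat_eq hnorm hinner) p) k
  simpa [muMat, Matrix.mul_apply, phiMat, mul_comm] using this

lemma phi_eq_sum (hs : s ∈ Set.Ioo (0 : ℝ) 1) (hnorm : ∀ i, ‖ψ i‖ = 1)
    (hinner : ∀ i j, i ≠ j → inner ℂ (ψ i) (ψ j) = (s : ℂ)) (k : Fin 6) :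
    phi ψ k = ∑ l, gramFun s Real.sqrt l k • mu ψ l := by
  ext p
  have := congrFun (congrFun (phiMat_eq hs hnorm hinner) p) k
  simpa [muMat, Matrix.mul_apply, phiMat, mul_comm] using this

lemma orthonormal_mu (hs : s ∈ Set.Ioo (0 : ℝ) 1) (hnorm : ∀ i, ‖ψ i‖ = 1)
    (hinner : ∀ i j, i ≠ j → inner ℂ (ψ i) (ψ j) = (s : ℂ)) : Orthonormal ℂ (mu ψ) := by
  rw [orthonormal_iff_ite]
  intro i j
  have h : inner ℂ (mu ψ i) (mu ψ j) = ((muMat ψ)ᴴ * muMat ψ) i j := by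
    simp [Matrix.mul_apply, muMat, PiLp.inner_apply, mul_comm]
  have hc : (gramFun s fun x => (√x)⁻¹)ᴴ = gramFun s fun x => (√x)⁻¹ := pattern_conjTranspose ..
  rw [h, muMat_eq hnorm hinner, Matrix.conjTranspose_mul, Matrix.mul_assoc,
    ← Matrix.mul_assoc _ (phiMat ψ), phiMat_conjTranspose_mul hnorm hinner, hc, gramFun_mul,
    gramFun_mul, gramFun_eq_one hs, Matrix.one_apply]
  intro x hx
  have : √x ≠ 0 := (Real.sqrt_pos.2 hx).ne'
  rw [id]
  field_simp
  rw [Real.sq_sqrt hx.le]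

lemma span_mu (hs : s ∈ Set.Ioo (0 : ℝ) 1) (hnorm : ∀ i, ‖ψ i‖ = 1)
    (hinner : ∀ i j, i ≠ j → inner ℂ (ψ i) (ψ j) = (s : ℂ)) :
    Submodule.span ℂ (Set.range (mu ψ)) = Submodule.span ℂ (Set.range (phi ψ)) := by
  refine le_antisymm (Submodule.span_le.2 ?_) (Submodule.span_le.2 ?_)
  · rintro _ ⟨k, rfl⟩
    rw [mu_eq_sum hnorm hinner]
    exact Submodule.sum_mem _ fun l _ =>
      Submodule.smul_mem _ _ (Submodule.subset_span (Set.mem_range_self l))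
  · rintro _ ⟨k, rfl⟩
    rw [phi_eq_sum hs hnorm hinner]
    exact Submodule.sum_mem _ fun l _ =>
      Submodule.smul_mem _ _ (Submodule.subset_span (Set.mem_range_self l))

/-! ### Convex hulls of compact sets in finite dimension -/

lemma isCompact_convexHull_of_finiteDimensional {E : Type*} [AddCommGroup E] [Module ℝ E]
    [TopologicalSpace E] [IsTopologicalAddGroup E] [ContinuousSMul ℝ E] [FiniteDimensional ℝ E]
    {S : Set E} (hS : IsCompact S) : IsCompact (convexHull ℝ S) := by
  rcases S.eq_empty_or_nonempty with rfl | ⟨s₀, hs₀⟩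
  · simp
  set I := Fin (Module.finrank ℝ E + 1)
  -- By Carathéodory's theorem the hull is the image of a compact set of weights and points.
  have himage : convexHull ℝ S = (fun x : (I → ℝ) × (I → E) => ∑ i, x.1 i • x.2 i) ''
      (stdSimplex ℝ I ×ˢ Set.univ.pi fun _ => S) := by
    refine Set.Subset.antisymm ?_ ?_
    · intro x hx
      obtain ⟨ι, _, z, w, hz, hind, hw, hw1, rfl⟩ := eq_pos_convex_span_of_mem_convexHull hx
      have hcard : Fintype.card ι ≤ Fintype.card I := by
        have := hind.card_le_finrank_succ
        rw [Fintype.card_fin]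
        exact this.trans (Nat.succ_le_succ (Submodule.finrank_le _))
      obtain ⟨e⟩ := Function.Embedding.nonempty_of_card_le hcard
      have hwe : ∀ i, Function.extend e w 0 (e i) = w i := e.injective.extend_apply w 0
      have hze : ∀ i, Function.extend e z (fun _ => s₀) (e i) = z i :=
        e.injective.extend_apply z _
      have hw0 : ∀ j ∉ Set.range e, Function.extend e w 0 j = 0 := fun j hj =>
        Function.extend_apply' _ _ _ (by simpa using hj)
      refine ⟨(Function.extend e w 0, Function.extend e z fun _ => s₀), ⟨⟨fun j => ?_, ?_⟩,
        fun j _ => ?_⟩, ?_⟩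
      · by_cases hj : j ∈ Set.range e
        · obtain ⟨i, rfl⟩ := hj
          simpa [hwe] using (hw i).le
        · exact (hw0 j hj).ge
      · rw [← hw1]
        exact (Fintype.sum_of_injective e e.injective _ _ hw0 fun i => (hwe i).symm).symm
      · by_cases hj : j ∈ Set.range e
        · obtain ⟨i, rfl⟩ := hj
          simpa [hze] using hz (Set.mem_range_self i)
        · have : Function.extend e z (fun _ => s₀) j = s₀ :=
            Function.extend_apply' _ _ _ (by simpa using hj)
          simpa [this] using hs₀
      · refine (Fintype.sum_of_injective e e.injective _ _ (fun j hj => ?_) fun i => ?_).symm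
        · simp [hw0 j hj]
        · simp [hwe, hze]
    · rintro _ ⟨⟨w, z⟩, ⟨hw, hz⟩, rfl⟩
      exact (convex_convexHull ℝ S).sum_mem (fun i _ => hw.1 i) hw.2
        fun i _ => subset_convexHull ℝ S (hz i trivial)
  rw [himage]
  exact ((isCompact_stdSimplex ℝ I).prod (isCompact_univ_pi fun _ => hS)).image (by fun_prop)

/-! ### Separable operators -/

/-- The rank-one product operator `|a ⊗ b⟩⟨a ⊗ b|`. -/
def prodOp {m n : ℕ} (a : EuclideanSpace ℂ (Fin m)) (b : EuclideanSpace ℂ (Fin n)) :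
    Matrix (Fin m × Fin n) (Fin m × Fin n) ℂ :=
  vecMulVec (tens a b).ofLp (star (tens a b).ofLp)

/-- The cone of (unnormalised) separable operators: finite sums of operators `|a ⊗ b⟩⟨a ⊗ b|`.
It is closed under nonnegative scaling because `a` is not normalised. -/
def separable (m n : ℕ) : AddSubmonoid (Matrix (Fin m × Fin n) (Fin m × Fin n) ℂ) :=
  AddSubmonoid.closure (Set.range fun x : EuclideanSpace ℂ (Fin m) × EuclideanSpace ℂ (Fin n) =>
    prodOp x.1 x.2)

lemma prodOp_mem_separable {m n : ℕ} (a : EuclideanSpace ℂ (Fin m))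
    (b : EuclideanSpace ℂ (Fin n)) : prodOp a b ∈ separable m n :=
  AddSubmonoid.subset_closure ⟨(a, b), rfl⟩

lemma prodOp_smul_left {m n : ℕ} (r : ℝ) (a : EuclideanSpace ℂ (Fin m))
    (b : EuclideanSpace ℂ (Fin n)) : prodOp ((r : ℂ) • a) b = (r ^ 2) • prodOp a b := by
  ext p q
  simp [prodOp, tens, vecMulVec_apply]
  ring

lemma smul_mem_separable {m n : ℕ} {r : ℝ} (hr : 0 ≤ r)
    {X : Matrix (Fin m × Fin n) (Fin m × Fin n) ℂ} (hX : X ∈ separable m n) :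
    r • X ∈ separable m n := by
  induction hX using AddSubmonoid.closure_induction with
  | mem x hx =>
    obtain ⟨⟨a, b⟩, rfl⟩ := hx
    have := prodOp_mem_separable (((√r : ℝ) : ℂ) • a) b
    rwa [prodOp_smul_left, Real.sq_sqrt hr] at this
  | zero => rw [smul_zero]; exact zero_mem _
  | add X Y _ _ hX hY => rw [smul_add]; exact add_mem hX hY

lemma posSemidef_of_mem_separable {m n : ℕ} {X : Matrix (Fin m × Fin n) (Fin m × Fin n) ℂ}
    (hX : X ∈ separable m n) : X.PosSemidef := by
  induction hX using AddSubmonoid.closure_induction with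
  | mem x hx =>
    obtain ⟨⟨a, b⟩, rfl⟩ := hx
    exact posSemidef_vecMulVec_self_star _
  | zero => exact PosSemidef.zero
  | add X Y _ _ hX hY => exact hX.add hY

lemma one_mem_separable (m n : ℕ) :
    (1 : Matrix (Fin m × Fin n) (Fin m × Fin n) ℂ) ∈ separable m n := by
  have : (1 : Matrix (Fin m × Fin n) (Fin m × Fin n) ℂ) =
      ∑ p : Fin m × Fin n, prodOp (EuclideanSpace.single p.1 1) (EuclideanSpace.single p.2 1) := by
    ext q r
    rw [Matrix.sum_apply, Finset.sum_eq_single q]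
    · obtain ⟨q1, q2⟩ := q
      obtain ⟨r1, r2⟩ := r
      simp [prodOp, tens, vecMulVec_apply, Matrix.one_apply, ← ite_and, eq_comm,
        and_comm]
    · intro p _ hp
      have : ¬ (q.1 = p.1 ∧ q.2 = p.2) := fun h => hp (Prod.ext h.1.symm h.2.symm)
      simp only [prodOp, tens, vecMulVec_apply, PiLp.single_apply]
      split_ifs <;> simp_all
    · simp
  rw [this]
  exact sum_mem fun p _ => prodOp_mem_separable _ _

lemma kronecker_one_conj_prodOp {m m' n : ℕ} (K : Matrix (Fin m') (Fin m) ℂ)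
    (a : EuclideanSpace ℂ (Fin m')) (b : EuclideanSpace ℂ (Fin n)) :
    (K ⊗ₖ (1 : Matrix (Fin n) (Fin n) ℂ))ᴴ * prodOp a b * (K ⊗ₖ (1 : Matrix (Fin n) (Fin n) ℂ)) =
      prodOp (WithLp.toLp 2 (Kᴴ *ᵥ a.ofLp)) b := by
  have h : (K ⊗ₖ (1 : Matrix (Fin n) (Fin n) ℂ))ᴴ *ᵥ (tens a b).ofLp =
      (tens (WithLp.toLp 2 (Kᴴ *ᵥ a.ofLp)) b).ofLp := by
    ext p
    simp [tens, Matrix.mulVec, dotProduct, Fintype.sum_prod_type, Matrix.one_apply,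
      Finset.sum_mul, apply_ite, mul_assoc]
  rw [prodOp, prodOp, mul_vecMulVec, vecMulVec_mul, ← h, star_mulVec, conjTranspose_conjTranspose]

lemma one_kronecker_conj_prodOp {m n n' : ℕ} (K : Matrix (Fin n') (Fin n) ℂ)
    (a : EuclideanSpace ℂ (Fin m)) (b : EuclideanSpace ℂ (Fin n')) :
    ((1 : Matrix (Fin m) (Fin m) ℂ) ⊗ₖ K)ᴴ * prodOp a b * ((1 : Matrix (Fin m) (Fin m) ℂ) ⊗ₖ K) =
      prodOp a (WithLp.toLp 2 (Kᴴ *ᵥ b.ofLp)) := by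
  have h : ((1 : Matrix (Fin m) (Fin m) ℂ) ⊗ₖ K)ᴴ *ᵥ (tens a b).ofLp =
      (tens a (WithLp.toLp 2 (Kᴴ *ᵥ b.ofLp))).ofLp := by
    ext p
    simp [tens, Matrix.mulVec, dotProduct, Fintype.sum_prod_type, Matrix.one_apply,
      Finset.mul_sum, apply_ite, mul_left_comm]
  rw [prodOp, prodOp, mul_vecMulVec, vecMulVec_mul, ← h, star_mulVec, conjTranspose_conjTranspose]

lemma kronecker_one_conj_mem_separable {m m' n : ℕ} (K : Matrix (Fin m') (Fin m) ℂ)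
    {X : Matrix (Fin m' × Fin n) (Fin m' × Fin n) ℂ} (hX : X ∈ separable m' n) :
    (K ⊗ₖ (1 : Matrix (Fin n) (Fin n) ℂ))ᴴ * X * (K ⊗ₖ (1 : Matrix (Fin n) (Fin n) ℂ)) ∈
      separable m n := by
  induction hX using AddSubmonoid.closure_induction with
  | mem x hx =>
    obtain ⟨⟨a, b⟩, rfl⟩ := hx
    rw [kronecker_one_conj_prodOp]
    exact prodOp_mem_separable _ _
  | zero => simp
  | add X Y _ _ hX hY => rw [Matrix.mul_add, Matrix.add_mul]; exact add_mem hX hY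

lemma one_kronecker_conj_mem_separable {m n n' : ℕ} (K : Matrix (Fin n') (Fin n) ℂ)
    {X : Matrix (Fin m × Fin n') (Fin m × Fin n') ℂ} (hX : X ∈ separable m n') :
    ((1 : Matrix (Fin m) (Fin m) ℂ) ⊗ₖ K)ᴴ * X * ((1 : Matrix (Fin m) (Fin m) ℂ) ⊗ₖ K) ∈
      separable m n := by
  induction hX using AddSubmonoid.closure_induction with
  | mem x hx =>
    obtain ⟨⟨a, b⟩, rfl⟩ := hx
    rw [one_kronecker_conj_prodOp]
    exact prodOp_mem_separable _ _
  | zero => simp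
  | add X Y _ _ hX hY => rw [Matrix.mul_add, Matrix.add_mul]; exact add_mem hX hY

lemma Protocol.effect_mem_separable {Ω : Type} [DecidableEq Ω] {m n : ℕ} (P : Protocol Ω m n)
    (ω : Ω) : P.effect ω ∈ separable m n := by
  induction P with
  | done ω' =>
    rw [Protocol.effect]
    split_ifs
    · exact one_mem_separable _ _
    · exact zero_mem _
  | alice k m' r K hK next ih =>
    rw [Protocol.effect]
    exact sum_mem fun i _ => sum_mem fun j _ => kronecker_one_conj_mem_separable _ (ih i)
  | bob k n' r K hK next ih =>
    rw [Protocol.effect]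
    exact sum_mem fun i _ => sum_mem fun j _ => one_kronecker_conj_mem_separable _ (ih i)

lemma Protocol.sum_effect {Ω : Type} [DecidableEq Ω] [Fintype Ω] {m n : ℕ}
    (P : Protocol Ω m n) : ∑ ω, P.effect ω = 1 := by
  induction P with
  | done ω' => simp [Protocol.effect]
  | @alice m n k m' r K hK next ih =>
    simp only [Protocol.effect]
    rw [Finset.sum_comm]
    have h : ∀ i, ∑ ω, ∑ j, (K i j ⊗ₖ (1 : Matrix (Fin n) (Fin n) ℂ))ᴴ * (next i).effect ω *
        (K i j ⊗ₖ (1 : Matrix (Fin n) (Fin n) ℂ)) =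
        ∑ j, ((K i j)ᴴ * K i j) ⊗ₖ (1 : Matrix (Fin n) (Fin n) ℂ) := fun i => by
      rw [Finset.sum_comm]
      refine Finset.sum_congr rfl fun j _ => ?_
      rw [← Matrix.sum_mul, ← Matrix.mul_sum, ih, Matrix.mul_one, conjTranspose_kronecker,
        ← mul_kronecker_mul]
      simp
    have hadd : ∀ {ι : Type} (t : Finset ι) (f : ι → Matrix (Fin m) (Fin m) ℂ),
        ∑ i ∈ t, f i ⊗ₖ (1 : Matrix (Fin n) (Fin n) ℂ) = (∑ i ∈ t, f i) ⊗ₖ 1 := fun t f => by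
      ext p q
      simp [Matrix.sum_apply, Finset.sum_mul]
    simp only [h, hadd, hK, one_kronecker_one]
  | @bob m n k n' r K hK next ih =>
    simp only [Protocol.effect]
    rw [Finset.sum_comm]
    have h : ∀ i, ∑ ω, ∑ j, ((1 : Matrix (Fin m) (Fin m) ℂ) ⊗ₖ K i j)ᴴ * (next i).effect ω *
        ((1 : Matrix (Fin m) (Fin m) ℂ) ⊗ₖ K i j) =
        ∑ j, (1 : Matrix (Fin m) (Fin m) ℂ) ⊗ₖ ((K i j)ᴴ * K i j) := fun i => by
      rw [Finset.sum_comm]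
      refine Finset.sum_congr rfl fun j _ => ?_
      rw [← Matrix.sum_mul, ← Matrix.mul_sum, ih, Matrix.mul_one, conjTranspose_kronecker,
        ← mul_kronecker_mul]
      simp
    have hadd : ∀ {ι : Type} (t : Finset ι) (f : ι → Matrix (Fin n) (Fin n) ℂ),
        ∑ i ∈ t, (1 : Matrix (Fin m) (Fin m) ℂ) ⊗ₖ f i = 1 ⊗ₖ (∑ i ∈ t, f i) := fun t f => by
      ext p q
      simp [Matrix.sum_apply, Finset.mul_sum]
    simp only [h, hadd, hK, one_kronecker_one]

/-! ### Separable operators form a closed set -/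

/-- The product operators with factors in the unit balls. -/
def unitProdOps (m n : ℕ) : Set (Matrix (Fin m × Fin n) (Fin m × Fin n) ℂ) :=
  (fun x : EuclideanSpace ℂ (Fin m) × EuclideanSpace ℂ (Fin n) => prodOp x.1 x.2) ''
    (Metric.closedBall 0 1 ×ˢ Metric.closedBall 0 1)

lemma isCompact_unitProdOps (m n : ℕ) : IsCompact (unitProdOps m n) := by
  refine ((isCompact_closedBall _ _).prod (isCompact_closedBall _ _)).image ?_
  refine continuous_matrix fun p q => ?_
  simp only [prodOp, tens, vecMulVec_apply, Pi.star_apply]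
  fun_prop

lemma trace_prodOp {m n : ℕ} (a : EuclideanSpace ℂ (Fin m)) (b : EuclideanSpace ℂ (Fin n)) :
    (prodOp a b).trace.re = (‖a‖ * ‖b‖) ^ 2 := by
  rw [mul_pow, EuclideanSpace.norm_sq_eq, EuclideanSpace.norm_sq_eq, Finset.sum_mul_sum]
  simp only [Matrix.trace, Matrix.diag_apply, prodOp, tens, vecMulVec_apply, Pi.star_apply,
    Fintype.sum_prod_type, Complex.re_sum, ← Complex.normSq_eq_norm_sq, Complex.normSq_apply]
  refine Finset.sum_congr rfl fun i _ => Finset.sum_congr rfl fun j _ => ?_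
  simp
  ring

/-- A separable operator `X` lies in `(tr X) • C`, where `C` is the convex hull of `unitProdOps`. -/
lemma mem_trace_smul_convexHull {m n : ℕ} {X : Matrix (Fin m × Fin n) (Fin m × Fin n) ℂ}
    (hX : X ∈ separable m n) :
    0 ≤ X.trace.re ∧ ∃ Y ∈ convexHull ℝ (unitProdOps m n), X = X.trace.re • Y := by
  induction hX using AddSubmonoid.closure_induction with
  | mem x hx =>
    obtain ⟨⟨a, b⟩, rfl⟩ := hx
    simp only [trace_prodOp]
    refine ⟨by positivity, ?_⟩
    have hunit : ∀ {l : ℕ} (c : EuclideanSpace ℂ (Fin l)), ∃ d, ‖d‖ ≤ 1 ∧ c = (‖c‖ : ℂ) • d := by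
      intro l c
      rcases eq_or_ne c 0 with rfl | hc
      · exact ⟨0, by simp, by simp⟩
      · have hc' : (‖c‖ : ℂ) ≠ 0 := by simpa using hc
        refine ⟨(‖c‖ : ℂ)⁻¹ • c, ?_, by rw [smul_smul, mul_inv_cancel₀ hc', one_smul]⟩
        rw [norm_smul, norm_inv]
        simp [hc]
    obtain ⟨a', ha', ha⟩ := hunit a
    obtain ⟨b', hb', hb⟩ := hunit b
    refine ⟨prodOp a' b', subset_convexHull ℝ _ ⟨(a', b'), by simp [ha', hb'], rfl⟩, ?_⟩
    have h : tens a b = ((‖a‖ * ‖b‖ : ℝ) : ℂ) • tens a' b' := by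
      conv_lhs => rw [ha, hb]
      ext p
      simp [tens]
      ring
    ext p q
    rw [prodOp, h]
    simp [prodOp, vecMulVec_apply]
    ring
  | zero =>
    refine ⟨by simp, prodOp 0 0, subset_convexHull ℝ _ ⟨(0, 0), by simp, rfl⟩, by simp⟩
  | add X Y _ _ hX hY =>
    obtain ⟨hX0, X', hX', hX⟩ := hX
    obtain ⟨hY0, Y', hY', hY⟩ := hY
    rw [Matrix.trace_add, Complex.add_re]
    refine ⟨by positivity, ?_⟩
    have := (convex_convexHull ℝ (unitProdOps m n)).add_smul hX0 hY0
    have hmem : X + Y ∈ (X.trace.re + Y.trace.re) • convexHull ℝ (unitProdOps m n) := by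
      rw [this]
      exact ⟨_, ⟨X', hX', hX.symm⟩, _, ⟨Y', hY', hY.symm⟩, rfl⟩
    obtain ⟨Z, hZ, hZe⟩ := hmem
    exact ⟨Z, hZ, hZe.symm⟩

lemma convexHull_unitProdOps_subset (m n : ℕ) :
    convexHull ℝ (unitProdOps m n) ⊆ separable m n := by
  refine convexHull_min ?_ ?_
  · rintro _ ⟨⟨a, b⟩, _, rfl⟩
    exact prodOp_mem_separable a b
  · intro X hX Y hY r t hr ht _
    exact add_mem (smul_mem_separable hr hX) (smul_mem_separable ht hY)

/-- A limit of separable operators is separable: the traces converge, and the convex hull of the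
unit product operators is compact. -/
lemma mem_separable_of_tendsto {m n : ℕ} {X : ℕ → Matrix (Fin m × Fin n) (Fin m × Fin n) ℂ}
    {Y : Matrix (Fin m × Fin n) (Fin m × Fin n) ℂ} (hX : ∀ t, X t ∈ separable m n)
    (h : Tendsto X atTop (𝓝 Y)) : Y ∈ separable m n := by
  have htr : Tendsto (fun t => (X t).trace.re) atTop (𝓝 Y.trace.re) :=
    ((Complex.continuous_re.comp (continuous_id.matrix_trace)).tendsto Y).comp h
  have hpos : 0 ≤ Y.trace.re :=
    ge_of_tendsto' htr fun t => (mem_trace_smul_convexHull (hX t)).1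
  choose hnn Z hZ hXZ using fun t => mem_trace_smul_convexHull (hX t)
  have : FirstCountableTopology (Matrix (Fin m × Fin n) (Fin m × Fin n) ℂ) :=
    inferInstanceAs (FirstCountableTopology (Fin m × Fin n → Fin m × Fin n → ℂ))
  obtain ⟨W, hW, θ, hθ, hlim⟩ :=
    (isCompact_convexHull_of_finiteDimensional (isCompact_unitProdOps m n)).tendsto_subseq hZ
  have h2 : Tendsto (fun t => (X (θ t)).trace.re • Z (θ t)) atTop (𝓝 (Y.trace.re • W)) :=
    (htr.comp hθ.tendsto_atTop).smul hlim
  have : Y = Y.trace.re • W := tendsto_nhds_unique (h.comp hθ.tendsto_atTop)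
    (h2.congr fun t => (hXZ (θ t)).symm)
  rw [this]
  exact smul_mem_separable hpos (convexHull_unitProdOps_subset m n hW)

/-- An LOCC measurement is a separable POVM. -/
lemma IsLOCC.separable_and_sum {Ω : Type} [DecidableEq Ω] [Fintype Ω] {m n : ℕ}
    {M : Ω → Matrix (Fin m × Fin n) (Fin m × Fin n) ℂ} (hM : IsLOCC M) :
    (∀ ω, M ω ∈ separable m n) ∧ ∑ ω, M ω = 1 := by
  obtain ⟨P, -, hlim⟩ := hM
  refine ⟨fun ω => mem_separable_of_tendsto (fun t => (P t).effect_mem_separable ω) (hlim ω), ?_⟩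
  refine tendsto_nhds_unique (tendsto_finsetSum _ fun ω _ => hlim ω) ?_
  simp only [Protocol.sum_effect]
  exact tendsto_const_nhds

/-! ### Columns of functions of the Gram matrix -/

/-- The diagonal entry of `gramFun s f`. -/
def diagCoeff (s : ℝ) (f : ℝ → ℝ) : ℝ :=
  (f (1 + 2 * s + 3 * s ^ 2) + f ((1 - s) ^ 2)) / 6 + (f (1 - s) + f ((1 - s) * (1 + 2 * s))) / 3

/-- The entry of `gramFun s f` at two pairs sharing exactly one position. -/
def shareCoeff (s : ℝ) (f : ℝ → ℝ) : ℝ :=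
  (f (1 + 2 * s + 3 * s ^ 2) - f ((1 - s) ^ 2) - f (1 - s) + f ((1 - s) * (1 + 2 * s))) / 6

/-- The entry of `gramFun s f` at two pairs that are swaps of each other. -/
def swapCoeff (s : ℝ) (f : ℝ → ℝ) : ℝ :=
  (f (1 + 2 * s + 3 * s ^ 2) - f ((1 - s) ^ 2)) / 6 + (f (1 - s) - f ((1 - s) * (1 + 2 * s))) / 3

/-- The entry of `gramFun s f` at two pairs that are cyclic shifts of each other. -/
def cycleCoeff (s : ℝ) (f : ℝ → ℝ) : ℝ :=
  (f (1 + 2 * s + 3 * s ^ 2) + f ((1 - s) ^ 2) - f (1 - s) - f ((1 - s) * (1 + 2 * s))) / 6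

lemma gramFun_apply (s : ℝ) (f : ℝ → ℝ) (k l : Fin 6) :
    gramFun s f k l = if k = l then (diagCoeff s f : ℂ)
      else if (pairs k).1 = (pairs l).1 ∨ (pairs k).2 = (pairs l).2 then (shareCoeff s f : ℂ)
      else if (pairs k).1 = (pairs l).2 ∧ (pairs k).2 = (pairs l).1 then (swapCoeff s f : ℂ)
      else (cycleCoeff s f : ℂ) := by
  simp only [gramFun, pattern, diagCoeff, shareCoeff, swapCoeff, cycleCoeff]
  split_ifs <;> rfl

lemma diagCoeff_pos (hs : s ∈ Set.Ioo (0 : ℝ) 1) {f : ℝ → ℝ} (hf : ∀ x > 0, 0 < f x) :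
    0 < diagCoeff s f := by
  obtain ⟨h0, h1⟩ := hs
  have h2 : 0 < 1 - s := by linarith
  have := hf _ (show 0 < 1 + 2 * s + 3 * s ^ 2 by positivity)
  have := hf _ (show 0 < (1 - s) ^ 2 by positivity)
  have := hf _ h2
  have := hf _ (show 0 < (1 - s) * (1 + 2 * s) by positivity)
  rw [diagCoeff]
  positivity

/-- The eigenvalues of the Gram matrix entering `shareCoeff` with opposite signs are ordered the
same way, so a strictly monotone function gives a nonzero entry. -/
lemma shareCoeff_pos (hs : s ∈ Set.Ioo (0 : ℝ) 1) {f : ℝ → ℝ}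
    (hf : StrictMonoOn f (Set.Ioi 0)) : 0 < shareCoeff s f := by
  obtain ⟨h0, h1⟩ := hs
  have h2 : 0 < 1 - s := by linarith
  have hA := hf (show 0 < (1 - s) ^ 2 by positivity) (show 0 < 1 + 2 * s + 3 * s ^ 2 by positivity)
    (by nlinarith)
  have hB := hf (show 0 < 1 - s by positivity) (show 0 < (1 - s) * (1 + 2 * s) by positivity)
    (by nlinarith)
  rw [shareCoeff]
  linarith

lemma shareCoeff_neg (s : ℝ) (f : ℝ → ℝ) : shareCoeff s (fun x => -f x) = -shareCoeff s f := by
  simp only [shareCoeff]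
  ring

lemma strictMonoOn_sqrt_Ioi : StrictMonoOn Real.sqrt (Set.Ioi 0) :=
  fun _ hx _ _ hxy => Real.sqrt_lt_sqrt (le_of_lt hx) hxy

lemma shareCoeff_inv_sqrt_ne_zero (hs : s ∈ Set.Ioo (0 : ℝ) 1) :
    shareCoeff s (fun x => (√x)⁻¹) ≠ 0 := by
  have h : StrictMonoOn (fun x => -(√x)⁻¹) (Set.Ioi 0) := fun x hx y hy hxy =>
    neg_lt_neg (inv_strictAnti₀ (Real.sqrt_pos.2 hx) (strictMonoOn_sqrt_Ioi hx hy hxy))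
  have := shareCoeff_pos hs h
  rw [shareCoeff_neg] at this
  exact (neg_pos.1 this).ne

/-- If the off-diagonal entries of a rank-one matrix are a nonzero multiple of a column of
`gramFun s f`, its diagonal is determined. -/
lemma exists_diagonal_of_column {f : ℝ → ℝ} (hα : diagCoeff s f ≠ 0) (hβ : shareCoeff s f ≠ 0)
    (k : Fin 6) : ∃ D : Fin 3 → ℂ, ∀ (a b : Fin 3 → ℂ) (c : ℂ), c ≠ 0 →
      (∀ n, a (pairs n).1 * b (pairs n).2 = c * gramFun s f n k) →
      ∀ m, a m * b m = c * D m := by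
  set α : ℂ := ((diagCoeff s f : ℝ) : ℂ) with hαdef
  set β : ℂ := ((shareCoeff s f : ℝ) : ℂ) with hβdef
  set δ : ℂ := ((cycleCoeff s f : ℝ) : ℂ) with hδdef
  have hα' : α ≠ 0 := by simpa [hαdef] using hα
  have hβ' : β ≠ 0 := by simpa [hβdef] using hβ
  -- Here `(i, j)` is the pair `k`, and `l` is the third index.
  have key : ∀ {ai aj al bi bj bl c : ℂ}, c ≠ 0 → ai * bj = c * α → ai * bl = c * β →
      al * bj = c * β → aj * bl = c * δ → al * bi = c * δ →
      ai * bi = c * (α * δ / β) ∧ aj * bj = c * (α * δ / β) ∧ al * bl = c * (β ^ 2 / α) := by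
    intro ai aj al bi bj bl c hc h1 h2 h3 h4 h5
    have hcα : c * α ≠ 0 := mul_ne_zero hc hα'
    have hcβ : c * β ≠ 0 := mul_ne_zero hc hβ'
    refine ⟨mul_right_cancel₀ hcβ ?_, mul_right_cancel₀ hcβ ?_, mul_right_cancel₀ hcα ?_⟩
    · calc ai * bi * (c * β) = (ai * bj) * (al * bi) := by rw [← h3]; ring
        _ = _ := by rw [h1, h5]; field_simp
    · calc aj * bj * (c * β) = (ai * bj) * (aj * bl) := by rw [← h2]; ring
        _ = _ := by rw [h1, h4]; field_simp
    · calc al * bl * (c * α) = (ai * bl) * (al * bj) := by rw [← h1]; ring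
        _ = _ := by rw [h2, h3]; field_simp
  refine ⟨fun m => if m = (pairs k).1 ∨ m = (pairs k).2 then α * δ / β else β ^ 2 / α, ?_⟩
  intro a b c hc h m
  have h0 := h 0
  have h1 := h 1
  have h2 := h 2
  have h3 := h 3
  have h4 := h 4
  have h5 := h 5
  clear h
  fin_cases k <;> simp [gramFun_apply, pairs, ← hαdef, ← hβdef, ← hδdef] at h0 h1 h2 h3 h4 h5
  · have := key hc h0 h1 h5 h3 h4
    fin_cases m <;> simp [pairs, this]
  · have := key hc h1 h0 h3 h5 h2
    fin_cases m <;> simp [pairs, this]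
  · have := key hc h2 h3 h4 h1 h5
    fin_cases m <;> simp [pairs, this]
  · have := key hc h3 h2 h1 h4 h0
    fin_cases m <;> simp [pairs, this]
  · have := key hc h4 h5 h2 h0 h3
    fin_cases m <;> simp [pairs, this]
  · have := key hc h5 h4 h0 h2 h1
    fin_cases m <;> simp [pairs, this]

/-- A rank-one matrix with zero diagonal cannot have the off-diagonal entries of a column of
`gramFun s f`. -/
lemma not_column_of_diagonal_eq_zero {f : ℝ → ℝ} (hβ : shareCoeff s f ≠ 0) (k : Fin 6)
    {a b : Fin 3 → ℂ} (h : ∀ n, a (pairs n).1 * b (pairs n).2 = gramFun s f n k)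
    (hd : ∀ m, a m * b m = 0) : False := by
  have hβ' : (shareCoeff s f : ℂ) ≠ 0 := by simpa using hβ
  have key : ∀ {ai al bj bl : ℂ}, ai * bl = shareCoeff s f → al * bj = shareCoeff s f →
      al * bl = 0 → False := by
    intro ai al bj bl h1 h2 h3
    rcases mul_eq_zero.1 h3 with h | h
    · exact hβ' (by rw [← h2, h, zero_mul])
    · exact hβ' (by rw [← h1, h, mul_zero])
  have h0 := h 0
  have h1 := h 1
  have h2 := h 2
  have h3 := h 3
  have h4 := h 4
  have h5 := h 5
  clear h
  fin_cases k <;> simp [gramFun_apply, pairs] at h0 h1 h2 h3 h4 h5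
  · exact key h1 h5 (hd 2)
  · exact key h0 h3 (hd 1)
  · exact key h3 h4 (hd 2)
  · exact key h2 h1 (hd 0)
  · exact key h5 h2 (hd 1)
  · exact key h4 h0 (hd 0)

/-! ### The dual basis -/

/-- The basis dual to `ψ`. -/
lemma exists_dual (hs : s ∈ Set.Ioo (0 : ℝ) 1) (hnorm : ∀ i, ‖ψ i‖ = 1)
    (hinner : ∀ i j, i ≠ j → inner ℂ (ψ i) (ψ j) = (s : ℂ)) :
    ∃ χ : Fin 3 → EuclideanSpace ℂ (Fin 3),
      ∀ i j, inner ℂ (ψ i) (χ j) = if i = j then (1 : ℂ) else 0 := by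
  have h1 : (1 + 2 * s : ℂ) ≠ 0 := by
    exact_mod_cast (show 1 + 2 * s ≠ 0 by linarith [hs.1])
  have h2 : (1 - s : ℂ) ≠ 0 := by
    exact_mod_cast (show 1 - s ≠ 0 by linarith [hs.2])
  refine ⟨fun j => ((1 + 2 * s) * (1 - s) : ℂ)⁻¹ • ((1 + 2 * s : ℂ) • ψ j - (s : ℂ) • (ψ 0 + ψ 1 + ψ 2)),
    fun i j => ?_⟩
  rw [inner_smul_right, inv_mul_eq_iff_eq_mul₀ (mul_ne_zero h1 h2)]
  simp only [inner_smul_right, inner_sub_right, inner_add_right, inner_eq_ite hnorm hinner]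
  fin_cases i <;> fin_cases j <;> simp <;> ring

/-- The nine products `ψ m ⊗ ψ n` are total. -/
lemma eq_zero_of_inner_tens_eq_zero (hs : s ∈ Set.Ioo (0 : ℝ) 1) (hnorm : ∀ i, ‖ψ i‖ = 1)
    (hinner : ∀ i j, i ≠ j → inner ℂ (ψ i) (ψ j) = (s : ℂ)) {x : EuclideanSpace ℂ (Fin 3 × Fin 3)}
    (hx : ∀ m n, inner ℂ (tens (ψ m) (ψ n)) x = 0) : x = 0 := by
  obtain ⟨χ, hχ⟩ := exists_dual hs hnorm hinner
  set A : Matrix (Fin 3) (Fin 3) ℂ := Matrix.of fun m i => star (ψ m i)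
  set B : Matrix (Fin 3) (Fin 3) ℂ := Matrix.of fun i n => χ n i
  have hAB : A * B = 1 := by
    ext m n
    rw [Matrix.one_apply, ← hχ]
    simp [A, B, Matrix.mul_apply, PiLp.inner_apply, mul_comm]
  have hBA : (B ⊗ₖ B) * (A ⊗ₖ A) = 1 := by
    rw [← mul_kronecker_mul, mul_eq_one_comm.1 hAB, one_kronecker_one]
  have hAx : (A ⊗ₖ A) *ᵥ x.ofLp = 0 := by
    ext p
    rw [Pi.zero_apply, ← hx p.1 p.2]
    simp [A, tens, Matrix.mulVec, dotProduct, PiLp.inner_apply, mul_comm]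
  have : x.ofLp = 0 := by
    rw [← Matrix.one_mulVec x.ofLp, ← hBA, ← Matrix.mulVec_mulVec, hAx, Matrix.mulVec_zero]
  ext p
  simp [this]

/-! ### Product vectors and the measurement vectors -/

/-- If `x` is orthogonal to all `μ j`, `j ≠ k`, its inner products with the `φ n` form a multiple of
the `k`-th column of the square root of the Gram matrix. -/
lemma inner_phi_of_orthogonal (hs : s ∈ Set.Ioo (0 : ℝ) 1) (hnorm : ∀ i, ‖ψ i‖ = 1)
    (hinner : ∀ i j, i ≠ j → inner ℂ (ψ i) (ψ j) = (s : ℂ)) {k : Fin 6}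
    {x : EuclideanSpace ℂ (Fin 3 × Fin 3)} (hx : ∀ j, j ≠ k → inner ℂ (mu ψ j) x = 0) (n : Fin 6) :
    inner ℂ (phi ψ n) x = inner ℂ (mu ψ k) x * gramFun s Real.sqrt n k := by
  have hc : star (gramFun s Real.sqrt k n) = gramFun s Real.sqrt n k :=
    congrFun (congrFun (pattern_conjTranspose _ _ _ _) n) k
  rw [phi_eq_sum hs hnorm hinner, sum_inner, Finset.sum_eq_single k]
  · rw [inner_smul_left, ← hc, mul_comm]
    rfl
  · intro j _ hj
    rw [inner_smul_left, hx j hj, mul_zero]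
  · simp

/-- Two product vectors orthogonal to all `μ j`, `j ≠ k`, but not to `μ k`, are proportional. -/
lemma smul_tens_eq_smul_tens (hs : s ∈ Set.Ioo (0 : ℝ) 1) (hnorm : ∀ i, ‖ψ i‖ = 1)
    (hinner : ∀ i j, i ≠ j → inner ℂ (ψ i) (ψ j) = (s : ℂ)) {k : Fin 6}
    {a b a' b' : EuclideanSpace ℂ (Fin 3)}
    (h : ∀ j, j ≠ k → inner ℂ (mu ψ j) (tens a b) = 0)
    (h' : ∀ j, j ≠ k → inner ℂ (mu ψ j) (tens a' b') = 0)
    (hk : inner ℂ (mu ψ k) (tens a b) ≠ 0) (hk' : inner ℂ (mu ψ k) (tens a' b') ≠ 0) :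
    inner ℂ (mu ψ k) (tens a' b') • tens a b = inner ℂ (mu ψ k) (tens a b) • tens a' b' := by
  obtain ⟨D, hD⟩ := exists_diagonal_of_column (s := s) (f := Real.sqrt)
    (diagCoeff_pos hs fun x hx => Real.sqrt_pos.2 hx).ne'
    (shareCoeff_pos hs strictMonoOn_sqrt_Ioi).ne' k
  have hoff := inner_phi_of_orthogonal hs hnorm hinner h
  have hoff' := inner_phi_of_orthogonal hs hnorm hinner h'
  simp only [phi, inner_tens] at hoff hoff'
  have hdiag := hD (fun m => inner ℂ (ψ m) a) (fun m => inner ℂ (ψ m) b) _ hk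
    (by simpa only [inner_tens] using hoff)
  have hdiag' := hD (fun m => inner ℂ (ψ m) a') (fun m => inner ℂ (ψ m) b') _ hk'
    (by simpa only [inner_tens] using hoff')
  have hpairs : ∀ m n : Fin 3, m ≠ n → ∃ l, pairs l = (m, n) := by
    unfold pairs
    decide
  rw [← sub_eq_zero]
  refine eq_zero_of_inner_tens_eq_zero hs hnorm hinner fun m n => ?_
  rw [inner_sub_right, inner_smul_right, inner_smul_right, inner_tens, inner_tens]
  by_cases hmn : m = n
  · subst hmn
    rw [hdiag m, hdiag' m]
    ring
  · obtain ⟨l, hl⟩ := hpairs m n hmn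
    have e := hoff l
    have e' := hoff' l
    rw [hl] at e e'
    rw [e, e']
    ring

/-- No `μ k` is a product vector: its coefficient matrix in the product basis `ψ m ⊗ ψ n` has zero
diagonal, but not rank one. -/
lemma mu_ne_tens (hs : s ∈ Set.Ioo (0 : ℝ) 1) (hnorm : ∀ i, ‖ψ i‖ = 1)
    (hinner : ∀ i j, i ≠ j → inner ℂ (ψ i) (ψ j) = (s : ℂ)) (k : Fin 6)
    (a b : EuclideanSpace ℂ (Fin 3)) : mu ψ k ≠ tens a b := by
  intro hab
  obtain ⟨χ, hχ⟩ := exists_dual hs hnorm hinner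
  have hχ' : ∀ i j, inner ℂ (χ i) (ψ j) = if i = j then (1 : ℂ) else 0 := fun i j => by
    rw [← inner_conj_symm, hχ]
    split_ifs <;> simp_all
  have hcoord : ∀ m n, inner ℂ (χ m) a * inner ℂ (χ n) b =
      ∑ l, gramFun s (fun x => (√x)⁻¹) l k * if (m, n) = pairs l then 1 else 0 := by
    intro m n
    rw [← inner_tens, ← hab, mu_eq_sum hnorm hinner, inner_sum]
    refine Finset.sum_congr rfl fun l _ => ?_
    rw [inner_smul_right, phi, inner_tens, hχ', hχ']
    congr 1
    simp only [Prod.ext_iff]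
    split_ifs <;> simp_all
  have hinj : ∀ n l, pairs n = pairs l ↔ n = l := by
    unfold pairs
    decide
  have hne : ∀ m l, (m, m) ≠ pairs l := by
    unfold pairs
    decide
  refine not_column_of_diagonal_eq_zero (shareCoeff_inv_sqrt_ne_zero hs) k
    (a := fun m => inner ℂ (χ m) a) (b := fun m => inner ℂ (χ m) b) (fun n => ?_) fun m => ?_
  · simp [hcoord, hinj]
  · simp [hcoord, hne]

/-! ### Separable discrimination is impossible -/

lemma prodOp_mulVec {m n : ℕ} (a : EuclideanSpace ℂ (Fin m)) (b : EuclideanSpace ℂ (Fin n))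
    (x : EuclideanSpace ℂ (Fin m × Fin n)) :
    prodOp a b *ᵥ x.ofLp = inner ℂ (tens a b) x • (tens a b).ofLp := by
  ext p
  simp only [prodOp, mulVec, dotProduct, vecMulVec_apply, Pi.smul_apply, smul_eq_mul,
    PiLp.inner_apply, Finset.sum_mul, Pi.star_apply]
  refine Finset.sum_congr rfl fun q _ => ?_
  simp
  ring

lemma star_dotProduct_prodOp_mulVec {m n : ℕ} (a : EuclideanSpace ℂ (Fin m))
    (b : EuclideanSpace ℂ (Fin n)) (x : EuclideanSpace ℂ (Fin m × Fin n)) :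
    star x.ofLp ⬝ᵥ (prodOp a b *ᵥ x.ofLp) = inner ℂ (tens a b) x * inner ℂ x (tens a b) := by
  rw [prodOp_mulVec, dotProduct_smul, smul_eq_mul, EuclideanSpace.inner_eq_star_dotProduct x,
    dotProduct_comm (star _)]

/-- A separable operator that never clicks on `v j`, `j ≠ k`, maps `v k` into the span of the
product vectors that are orthogonal to all those `v j` but not to `v k`. -/
lemma mulVec_mem_span_of_mem_separable {ι : Type*} {m n : ℕ}
    {v : ι → EuclideanSpace ℂ (Fin m × Fin n)} {k : ι}
    {X : Matrix (Fin m × Fin n) (Fin m × Fin n) ℂ} (hX : X ∈ separable m n)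
    (h : ∀ j, j ≠ k → star (v j).ofLp ⬝ᵥ (X *ᵥ (v j).ofLp) = 0) :
    WithLp.toLp 2 (X *ᵥ (v k).ofLp) ∈ Submodule.span ℂ {x | ∃ a b, x = tens a b ∧
      (∀ j, j ≠ k → inner ℂ (v j) x = 0) ∧ inner ℂ (v k) x ≠ 0} := by
  induction hX using AddSubmonoid.closure_induction with
  | mem X hX =>
    obtain ⟨⟨a, b⟩, rfl⟩ := hX
    simp only [prodOp_mulVec, WithLp.toLp_smul]
    by_cases hk : inner ℂ (v k) (tens a b) = 0
    · rw [← inner_conj_symm, hk]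
      simp
    · refine Submodule.smul_mem _ _ (Submodule.subset_span ⟨a, b, rfl, fun j hj => ?_, hk⟩)
      have := h j hj
      simp only [star_dotProduct_prodOp_mulVec] at this
      rcases mul_eq_zero.1 this with h0 | h0
      · rw [← inner_conj_symm, h0, map_zero]
      · exact h0
  | zero => simp
  | add X Y hX hY ihX ihY =>
    rw [Matrix.add_mulVec, WithLp.toLp_add]
    have hsum : ∀ j, j ≠ k → star (v j).ofLp ⬝ᵥ (X *ᵥ (v j).ofLp) = 0 ∧
        star (v j).ofLp ⬝ᵥ (Y *ᵥ (v j).ofLp) = 0 := fun j hj => by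
      have hpX := (posSemidef_of_mem_separable hX).dotProduct_mulVec_nonneg (v j).ofLp
      have hpY := (posSemidef_of_mem_separable hY).dotProduct_mulVec_nonneg (v j).ofLp
      have := h j hj
      rw [Matrix.add_mulVec, dotProduct_add] at this
      exact (add_eq_zero_iff_of_nonneg hpX hpY).1 this
    exact add_mem (ihX fun j hj => (hsum j hj).1) (ihY fun j hj => (hsum j hj).2)

/-- The effect of a perfectly discriminating POVM that announces `k` fixes the `k`-th state, since
all other effects annihilate it. -/
lemma PerfectlyDiscriminates.mulVec_eq {Ω X : Type} [DecidableEq Ω] [Fintype Ω] [Fintype X]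
    [DecidableEq X] {M : Ω → Matrix X X ℂ} {v : Ω → EuclideanSpace ℂ X}
    (h : PerfectlyDiscriminates M v) (hpos : ∀ i, (M i).PosSemidef) (hsum : ∑ i, M i = 1)
    (k : Ω) : M k *ᵥ (v k).ofLp = (v k).ofLp := by
  have h1 : (∑ i, M i) *ᵥ (v k).ofLp = (v k).ofLp := by rw [hsum, Matrix.one_mulVec]
  rw [Matrix.sum_mulVec, Finset.sum_eq_single k] at h1
  · exact h1
  · intro i _ hik
    rw [← (hpos i).dotProduct_mulVec_zero_iff, h i k, if_neg hik]
  · simp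

lemma not_perfectlyDiscriminates_of_separable (hs : s ∈ Set.Ioo (0 : ℝ) 1)
    (hnorm : ∀ i, ‖ψ i‖ = 1) (hinner : ∀ i j, i ≠ j → inner ℂ (ψ i) (ψ j) = (s : ℂ))
    {M : Fin 6 → Matrix (Fin 3 × Fin 3) (Fin 3 × Fin 3) ℂ} (hM : ∀ i, M i ∈ separable 3 3)
    (hsum : ∑ i, M i = 1) : ¬ PerfectlyDiscriminates M (mu ψ) := by
  intro h
  have hfix := h.mulVec_eq (fun i => posSemidef_of_mem_separable (hM i)) hsum 0
  have hmem := mulVec_mem_span_of_mem_separable (v := mu ψ) (k := 0) (hM 0) fun j hj => by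
    rw [h 0 j, if_neg hj.symm]
  rw [hfix] at hmem
  set S : Set (EuclideanSpace ℂ (Fin 3 × Fin 3)) := {x | ∃ a b, x = tens a b ∧
      (∀ j, j ≠ 0 → inner ℂ (mu ψ j) x = 0) ∧ inner ℂ (mu ψ 0) x ≠ 0} with hS
  -- The span is at most one-dimensional and spanned by a product vector.
  have hline : ∃ a b, Submodule.span ℂ S ≤ Submodule.span ℂ {tens a b} := by
    rcases S.eq_empty_or_nonempty with he | ⟨_, a, b, rfl, hab, hab0⟩
    · exact ⟨0, 0, by simp [he]⟩
    · refine ⟨a, b, Submodule.span_le.2 ?_⟩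
      rintro _ ⟨c, d, rfl, hcd, hcd0⟩
      refine Submodule.mem_span_singleton.2
        ⟨(inner ℂ (mu ψ 0) (tens a b))⁻¹ * inner ℂ (mu ψ 0) (tens c d), ?_⟩
      rw [mul_smul, smul_tens_eq_smul_tens hs hnorm hinner hab hcd hab0 hcd0, smul_smul,
        inv_mul_cancel₀ hab0, one_smul]
  obtain ⟨a, b, hab⟩ := hline
  obtain ⟨r, hr⟩ := Submodule.mem_span_singleton.1 (hab hmem)
  refine mu_ne_tens hs hnorm hinner 0 (r • a) b ?_
  have hr' : mu ψ 0 = r • tens a b := hr.symm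
  rw [hr']
  ext p
  simp [tens, mul_assoc]

end LOCCDisc

end

theorem mainTheorem2 (s : ℝ) (hs : s ∈ Set.Ioo (0 : ℝ) 1)
    (ψ : Fin 3 → EuclideanSpace ℂ (Fin 3))
    (hnorm : ∀ i, ‖ψ i‖ = 1)
    (hinner : ∀ i j, i ≠ j → inner ℂ (ψ i) (ψ j) = (s : ℂ)) :
    (Orthonormal ℂ (LOCCDisc.mu ψ) ∧
      Submodule.span ℂ (Set.range (LOCCDisc.mu ψ)) =
        Submodule.span ℂ (Set.range (LOCCDisc.phi ψ))) ∧
    (¬ ∃ M : Fin 6 → Matrix (Fin 3 × Fin 3) (Fin 3 × Fin 3) ℂ,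
      LOCCDisc.IsLOCC M ∧ LOCCDisc.PerfectlyDiscriminates M (LOCCDisc.mu ψ)) ∧
    (∀ (i : Fin 6) (a b c d : EuclideanSpace ℂ (Fin 3)),
      (∀ j, j ≠ i → inner ℂ (LOCCDisc.mu ψ j) (LOCCDisc.tens a b) = 0) →
      (∀ j, j ≠ i → inner ℂ (LOCCDisc.mu ψ j) (LOCCDisc.tens c d) = 0) →
      inner ℂ (LOCCDisc.mu ψ i) (LOCCDisc.tens a b) ≠ 0 →
      inner ℂ (LOCCDisc.mu ψ i) (LOCCDisc.tens c d) ≠ 0 →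
      ¬ LinearIndependent ℂ ![LOCCDisc.tens a b, LOCCDisc.tens c d]) := by
  refine ⟨⟨LOCCDisc.orthonormal_mu hs hnorm hinner, LOCCDisc.span_mu hs hnorm hinner⟩, ?_, ?_⟩
  · rintro ⟨M, hM, hdisc⟩
    obtain ⟨hsep, hsum⟩ := hM.separable_and_sum
    exact LOCCDisc.not_perfectlyDiscriminates_of_separable hs hnorm hinner hsep hsum hdisc
  · intro i a b c d hab hcd hab0 hcd0 hind
    have h := LOCCDisc.smul_tens_eq_smul_tens hs hnorm hinner hab hcd hab0 hcd0
    refine hcd0 (LinearIndependent.pair_iff.1 hind _ (-inner ℂ (LOCCDisc.mu ψ i)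
      (LOCCDisc.tens a b)) ?_).1
    rw [h, neg_smul, add_neg_cancel]
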